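/- Let $p\equiv 1\pmod 4$ and $q\equiv 3\pmod 4$ be primes with $q-p=2$, and put $N=pq$. Let $g$ be a common primitive root of $p$ and $q$, let $x$ be the solution (unique modulo $N$) of $x\equiv g\pmod p$, $x\equiv 1\pmod q$, and define $$D_i=\{g^{s}x^{i}\bmod N: 0\le s<(p-1)(q-1)/2\},$$ $$D_i^{(p)}=\{g^{2t+i}\bmod p: 0\le t<(p-1)/2\},\qquad D_i^{(q)}=\{g^{2t+i}\bmod q: 0\le t<(q-1)/2\}$$ for $i=0,1$. Then $\mathbb Z_N$ is the disjoint union of $C_0=\{0\}\cup D_0\cup D_0^{(p)}q\cup D_0^{(q)}p$ and $C_1=D_1\cup D_1^{(p)}q\cup D_1^{(q)}p$, and the balanced Whiteman generalized cyclotomic sequence $s=\{s_i\}$ of period $N$ is defined by $s_i=0$ if $i \bmod N\in C_0$ and $s_i=1$ if $i\bmod N\in C_1$. The 2-adic complexity of a binary sequence $s$ of period $N$ is $\varphi_2(s)=\lfloor\log_2(n+1)\rfloor$, where $$\frac{\sum_{i=0}^{N-1}s_i2^i}{2^N-1}=\frac mn,\qquad 0\le m\le n,\quad \gcd(m,n)=1.$$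 Then the 2-adic complexity of the sequence $s$ is maximal, that is, $\varphi_2(s)=N$. -/

import Mathlib

/-- `g` is a primitive root modulo the prime `p`: the class of `g` has multiplicative order `p - 1`
in `ℤ/pℤ`. -/
def IsPrimitiveRootMod (g : ℤ) (p : ℕ) : Prop :=
  orderOf (g : ZMod p) = p - 1

/-- The Whiteman generalized cyclotomic class of order 2,
`D_i = {g ^ s * x ^ i mod pq : s = 0, …, (p - 1)(q - 1)/2 - 1}`. -/
def whitemanClass (p q : ℕ) (g x : ℤ) (i : ℕ) : Finset (ZMod (p * q)) :=
  (Finset.range ((p - 1) * (q - 1) / 2)).image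
    fun s => (g : ZMod (p * q)) ^ s * (x : ZMod (p * q)) ^ i

/-- The classical cyclotomic class of order 2 modulo `p`,
`D_i^(p) = {g ^ (2 t + i) mod p : t = 0, …, (p - 1)/2 - 1}`, as a set of least nonnegative
residues. -/
def cyclotomicClass (p : ℕ) (g : ℤ) (i : ℕ) : Finset ℤ :=
  (Finset.range ((p - 1) / 2)).image fun t => g ^ (2 * t + i) % (p : ℤ)

/-- `D_i^(p) q = {y q : y ∈ D_i^(p)}`, viewed in `ℤ/pqℤ`. -/
def scaledClassP (p q : ℕ) (g : ℤ) (i : ℕ) : Finset (ZMod (p * q)) :=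
  (cyclotomicClass p g i).image fun y => ((y * (q : ℤ) : ℤ) : ZMod (p * q))

/-- `D_i^(q) p = {y p : y ∈ D_i^(q)}`, viewed in `ℤ/pqℤ`. -/
def scaledClassQ (p q : ℕ) (g : ℤ) (i : ℕ) : Finset (ZMod (p * q)) :=
  (cyclotomicClass q g i).image fun y => ((y * (p : ℤ) : ℤ) : ZMod (p * q))

/-- `C₁ = D_1 ∪ D_1^(p) q ∪ D_1^(q) p`. Its complement in `ℤ/pqℤ` is
`C₀ = {0} ∪ D_0 ∪ D_0^(p) q ∪ D_0^(q) p`. -/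
def whitemanSupport (p q : ℕ) (g x : ℤ) : Finset (ZMod (p * q)) :=
  whitemanClass p q g x 1 ∪ scaledClassP p q g 1 ∪ scaledClassQ p q g 1

/-- The balanced Whiteman generalized cyclotomic sequence of order 2 and period `pq`:
`s_i = 1` if `i mod pq` lies in `C₁`, and `s_i = 0` otherwise (that is, if it lies in `C₀`). -/
def whitemanSequence (p q : ℕ) (g x : ℤ) (i : ℕ) : ℕ :=
  if (i : ZMod (p * q)) ∈ whitemanSupport p q g x then 1 else 0

/-- The 2-adic complexity of a binary sequence `s` of period `N`: `⌊log₂ (n + 1)⌋`, where `n` is the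
denominator in lowest terms of `(∑_{i < N} s_i 2 ^ i) / (2 ^ N - 1)`. -/
noncomputable def twoAdicComplexity (N : ℕ) (s : ℕ → ℕ) : ℕ :=
  ⌊Real.logb 2
    (((((∑ i ∈ Finset.range N, s i * 2 ^ i : ℕ) : ℚ) / ((2 : ℚ) ^ N - 1)).den : ℝ) + 1)⌋₊

/-! Let `r` be an odd prime. Identify `ℤ/pq` with `ℤ/p × ℤ/q`. Under quadratic reciprocity,
which gives `(q/p) = (p/q) =: ε` as soon as one of the primes is `1` modulo `4`, the
`±1`-version of the sequence is a product `u(a) v(b)` of two functions, where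
`u` and `v` are `ε` times the Legendre symbol except for the value `1` at `0`. Hence its
sum against an additive character `ψ₁ψ₂` with values in `𝔽_r` is `(1 + ε G(ψ₁)) (1 + ε G(ψ₂))`, with
`G` the quadratic Gauss sums.

If `1 + ε G(ψ₁) = 0`, then `G(ψ₁)² = 1`, so `p² = 1` in `𝔽_r`, that is, `r` divides `p - 1` or
`p + 1`. But `ψ₁` is then nontrivial, so `𝔽_r` contains a `p`-th root of unity other than `1` and
`p ∣ r - 1`, which is impossible for two odd primes. Now take `j ↦ 2 ^ j` for `ψ₁ψ₂`: no prime
divides both `∑ sᵢ 2 ^ i` and `2 ^ (p * q) - 1`.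
-/

open Finset

section TwoAdicComplexity

theorem twoAdicComplexity_eq_of_coprime {N : ℕ} {s : ℕ → ℕ} (hN : N ≠ 0)
    (h : (∑ i ∈ range N, s i * 2 ^ i).Coprime (2 ^ N - 1)) : twoAdicComplexity N s = N := by
  have hpos : 0 < 2 ^ N - 1 := Nat.sub_pos_of_lt (Nat.one_lt_two_pow hN)
  have hcast : ((2 ^ N - 1 : ℕ) : ℚ) = 2 ^ N - 1 := by simp [Nat.cast_sub Nat.one_le_two_pow]
  have hden : (((∑ i ∈ range N, s i * 2 ^ i : ℕ) : ℚ) / ((2 : ℚ) ^ N - 1)).den = 2 ^ N - 1 := by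
    rw [← hcast]
    exact Nat.cast_injective (R := ℤ) (Rat.den_div_eq_of_coprime
      (a := (∑ i ∈ range N, s i * 2 ^ i : ℕ)) (b := (2 ^ N - 1 : ℕ)) (Nat.cast_pos.mpr hpos) h)
  rw [twoAdicComplexity, hden, Nat.cast_sub Nat.one_le_two_pow, Nat.cast_pow, Nat.cast_one,
    sub_add_cancel, Nat.cast_ofNat, Real.logb_pow, Real.logb_self_eq_one one_lt_two, mul_one,
    Nat.floor_natCast]

theorem sum_range_natCast_zmod {M : Type*} [AddCommMonoid M] {N : ℕ} [NeZero N] (f : ZMod N → M) :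
    ∑ i ∈ range N, f i = ∑ j, f j :=
  sum_nbij' (fun i => (i : ZMod N)) ZMod.val (fun _ _ => mem_univ _)
    (fun j _ => mem_range.mpr (ZMod.val_lt j)) (fun _ hi => ZMod.val_cast_of_lt (mem_range.mp hi))
    (fun j _ => ZMod.natCast_zmod_val j) fun _ _ => rfl

/-- The `±1`-valued function `(-1) ^ 1_S` attached to a finite set `S`. For the support of a binary
sequence `s` it is `(-1) ^ s`, whose character sums are easier to factor than those of `s`. -/
def signedIndicator {α : Type*} [DecidableEq α] (S : Finset α) (j : α) : ℤ :=
  if j ∈ S then -1 else 1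

theorem sum_signedIndicator_mul_addChar {A R : Type*} [AddGroup A] [Fintype A] [DecidableEq A]
    [CommRing R] [IsDomain R] (S : Finset A) {ψ : AddChar A R} (hψ : ψ ≠ 1) :
    ∑ j, (signedIndicator S j : R) * ψ j = -2 * ∑ j, (if j ∈ S then 1 else 0) * ψ j := by
  have hsplit (j : A) : (signedIndicator S j : R) * ψ j =
      ψ j - 2 * ((if j ∈ S then 1 else 0) * ψ j) := by
    by_cases hj : j ∈ S <;> simp only [signedIndicator, hj, if_true, if_false] <;> push_cast <;>
      ring
  simp only [hsplit, sum_sub_distrib, ← mul_sum, AddChar.sum_eq_zero_of_ne_one hψ, zero_sub,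
    neg_mul]

theorem twoAdicComplexity_indicator_eq {N : ℕ} [NeZero N] (S : Finset (ZMod N))
    (h : ∀ (r : ℕ) [Fact r.Prime], r ≠ 2 → ∀ ψ : AddChar (ZMod N) (ZMod r), ψ ≠ 1 →
      ∑ j, (signedIndicator S j : ZMod r) * ψ j ≠ 0) :
    twoAdicComplexity N (fun i => if (i : ZMod N) ∈ S then 1 else 0) = N := by
  refine twoAdicComplexity_eq_of_coprime (NeZero.ne N) (Nat.coprime_of_dvd fun r hr hsum hN => ?_)
  have : Fact r.Prime := ⟨hr⟩
  have hpow : (2 : ZMod r) ^ N = 1 := by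
    have h0 := (ZMod.natCast_eq_zero_iff _ _).mpr hN
    rw [Nat.cast_sub Nat.one_le_two_pow] at h0
    exact_mod_cast sub_eq_zero.mp h0
  have hr2 : r ≠ 2 := by
    rintro rfl
    have h2 : (2 : ZMod 2) = 0 := rfl
    exact zero_ne_one ((zero_pow (NeZero.ne N)).symm.trans (h2 ▸ hpow))
  have hψ (i : ℕ) : AddChar.zmodChar N hpow i = 2 ^ i := AddChar.zmodChar_apply' hpow i
  have hψ1 : AddChar.zmodChar N hpow ≠ 1 := by
    intro h1
    have h2 : (1 : ZMod r) = 2 ^ 1 := by rw [← hψ 1, h1, AddChar.one_apply]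
    exact one_ne_zero (α := ZMod r) (by linear_combination -h2)
  refine h r hr2 _ hψ1 ?_
  have hsum0 := (ZMod.natCast_eq_zero_iff _ _).mpr hsum
  push_cast at hsum0
  rw [sum_signedIndicator_mul_addChar S hψ1, ← sum_range_natCast_zmod]
  simp only [hψ, hsum0, mul_zero]

end TwoAdicComplexity

section QuadraticCharacter

variable {K : Type*} [Field K] [Fintype K] [DecidableEq K]

theorem quadraticChar_div (a b : K) :
    quadraticChar K (a / b) = quadraticChar K a * quadraticChar K b := by
  rw [div_eq_mul_inv, map_mul, ← MulChar.inv_apply', (quadraticChar_isQuadratic K).inv]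

/-- The quadratic Gauss sum of a finite field `K`, for an additive character with values in an
arbitrary commutative ring `R`, in which the values `0, ±1` of the quadratic character are read. -/
noncomputable def quadraticGaussSum {R : Type*} [CommRing R] (ψ : AddChar K R) : R :=
  gaussSum ((quadraticChar K).ringHomComp (Int.castRingHom R)) ψ

theorem quadraticGaussSum_eq_sum {R : Type*} [CommRing R] (ψ : AddChar K R) :
    quadraticGaussSum ψ = ∑ a, (quadraticChar K a : R) * ψ a := rfl

theorem quadraticGaussSum_one (hK : ringChar K ≠ 2) {R : Type*} [CommRing R] :
    quadraticGaussSum (1 : AddChar K R) = 0 := by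
  simp only [quadraticGaussSum_eq_sum, AddChar.one_apply, mul_one, ← Int.cast_sum,
    quadraticChar_sum_zero hK, Int.cast_zero]

theorem quadraticGaussSum_sq (hK : ringChar K ≠ 2) {R : Type*} [CommRing R] [IsDomain R]
    (hR : (2 : R) ≠ 0) {ψ : AddChar K R} (hψ : ψ ≠ 1) :
    quadraticGaussSum ψ ^ 2 = (quadraticChar K (-1) : R) * Fintype.card K := by
  have hχ : (quadraticChar K).ringHomComp (Int.castRingHom R) ≠ 1 := by
    obtain ⟨a, ha⟩ := quadraticChar_exists_neg_one' hK
    intro h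
    have h1 := DFunLike.congr_fun h (a : K)
    simp only [MulChar.ringHomComp_apply, ha, MulChar.one_apply_coe, map_neg, map_one] at h1
    exact hR (by linear_combination -h1)
  exact gaussSum_sq hχ ((quadraticChar_isQuadratic K).comp _) (AddChar.IsPrimitive.of_ne_one hψ)

/-- The function on a finite field `K` equal to `ε` times the quadratic character away from `0`, and
to `1` at `0`; when `ε = ±1` it takes the values `±1` only. It is the factor on each component of
`ℤ/pq ≃ ℤ/p × ℤ/q` of the `±1`-version of the Whiteman sequence. -/
def signedQuadraticChar (ε : ℤ) (a : K) : ℤ :=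
  if a = 0 then 1 else ε * quadraticChar K a

theorem sum_signedQuadraticChar_mul_addChar {R : Type*} [CommRing R] (ε : ℤ) (ψ : AddChar K R) :
    ∑ a, (signedQuadraticChar ε a : R) * ψ a = 1 + ε * quadraticGaussSum ψ := by
  have hsplit (a : K) : (signedQuadraticChar ε a : R) * ψ a =
      (if a = 0 then ψ a else 0) + ε * ((quadraticChar K a : R) * ψ a) := by
    by_cases ha : a = 0
    · simp [signedQuadraticChar, ha]
    · simp [signedQuadraticChar, ha, mul_assoc]
  simp only [hsplit, sum_add_distrib, ← mul_sum, quadraticGaussSum_eq_sum, sum_ite_eq',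
    mem_univ, if_true, AddChar.map_zero_eq_one]

end QuadraticCharacter

section NonvanishingGaussSum

theorem prime_dvd_card_sub_one_of_addChar_ne_one {F : Type*} [Field F] [Fintype F] {p : ℕ}
    [Fact p.Prime] {ψ : AddChar (ZMod p) F} (hψ : ψ ≠ 1) : p ∣ Fintype.card F - 1 := by
  obtain ⟨a, ha⟩ := AddChar.ne_one_iff.mp hψ
  have hpow : ψ a ^ p = 1 := by
    rw [← AddChar.map_nsmul_eq_pow, nsmul_eq_mul, CharP.cast_eq_zero, zero_mul,
      AddChar.map_zero_eq_one]
  rw [← orderOf_eq_prime hpow ha]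
  exact orderOf_dvd_of_pow_eq_one
    (FiniteField.pow_card_sub_one_eq_one _ (ψ.val_isUnit a).ne_zero)

theorem natCast_zmod_sq_ne_one {n r : ℕ} [Fact r.Prime] (hn : 1 < n) (hnr : n + 1 < r) :
    (n : ZMod r) ^ 2 ≠ 1 := by
  intro h
  rcases sq_eq_one_iff.mp h with h1 | h1
  · have h0 : ((n - 1 : ℕ) : ZMod r) = 0 := by rw [Nat.cast_sub hn.le, h1, Nat.cast_one, sub_self]
    have := Nat.le_of_dvd (by omega) ((ZMod.natCast_eq_zero_iff _ _).mp h0)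
    omega
  · have h0 : ((n + 1 : ℕ) : ZMod r) = 0 := by rw [Nat.cast_add, h1, Nat.cast_one, neg_add_cancel]
    have := Nat.le_of_dvd (by omega) ((ZMod.natCast_eq_zero_iff _ _).mp h0)
    omega

theorem add_one_lt_of_odd_of_dvd_sub_one {m n : ℕ} (hm : Odd m) (hn : Odd n) (hn1 : 1 < n)
    (h : m ∣ n - 1) : m + 1 < n := by
  have := Nat.le_of_dvd (by omega) h
  rw [Nat.odd_iff] at hm hn
  omega

theorem one_add_mul_quadraticGaussSum_ne_zero {p r : ℕ} [Fact p.Prime] [Fact r.Prime]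
    (hp : p ≠ 2) (hr : r ≠ 2) {ε : ℤ} (hε : ε ^ 2 = 1) (ψ : AddChar (ZMod p) (ZMod r)) :
    1 + (ε : ZMod r) * quadraticGaussSum ψ ≠ 0 := by
  have hp' : ringChar (ZMod p) ≠ 2 := by rwa [ZMod.ringChar_zmod_n]
  have hr' : (2 : ZMod r) ≠ 0 := Ring.two_ne_zero (by rwa [ZMod.ringChar_zmod_n])
  have hp1 := (Fact.out : p.Prime).one_lt
  intro h
  have hψ : ψ ≠ 1 := by
    rintro rfl
    rw [quadraticGaussSum_one hp', mul_zero, add_zero] at h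
    exact one_ne_zero h
  have hG : quadraticGaussSum ψ ^ 2 = 1 := by
    have hε' : (ε : ZMod r) ^ 2 = 1 := by exact_mod_cast congrArg (Int.cast : ℤ → ZMod r) hε
    linear_combination (ε * quadraticGaussSum ψ - 1) * h - quadraticGaussSum ψ ^ 2 * hε'
  have hpsq : (p : ZMod r) ^ 2 = 1 := by
    have hsign : (quadraticChar (ZMod p) (-1) : ZMod r) ^ 2 = 1 := by
      exact_mod_cast congrArg (Int.cast : ℤ → ZMod r)
        (quadraticChar_sq_one (neg_ne_zero.mpr (one_ne_zero (α := ZMod p))))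
    rw [quadraticGaussSum_sq hp' hr' hψ, ZMod.card] at hG
    rw [← one_mul ((p : ZMod r) ^ 2), ← hsign, ← mul_pow, hG, one_pow, hsign]
  have hdvd : p ∣ r - 1 := by simpa using prime_dvd_card_sub_one_of_addChar_ne_one hψ
  exact natCast_zmod_sq_ne_one hp1
    (add_one_lt_of_odd_of_dvd_sub_one ((Fact.out : p.Prime).odd_of_ne_two hp)
      ((Fact.out : r.Prime).odd_of_ne_two hr) (Fact.out : r.Prime).one_lt hdvd) hpsq

theorem sum_prod_mul_addChar {A B R : Type*} [AddGroup A] [AddGroup B] [Fintype A] [Fintype B]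
    [CommRing R] (f : A → R) (h : B → R) (ψ : AddChar (A × B) R) :
    ∑ c, f c.1 * h c.2 * ψ c =
      (∑ a, f a * ψ.compAddMonoidHom (AddMonoidHom.inl A B) a) *
        ∑ b, h b * ψ.compAddMonoidHom (AddMonoidHom.inr A B) b := by
  rw [Fintype.sum_mul_sum, Fintype.sum_prod_type]
  refine sum_congr rfl fun a _ => sum_congr rfl fun b _ => ?_
  have hψ : ψ (a, b) = ψ (a, 0) * ψ (0, b) := by
    rw [← AddChar.map_add_eq_mul, Prod.mk_add_mk, add_zero, zero_add]
  simp only [hψ, AddChar.compAddMonoidHom_apply, AddMonoidHom.inl_apply, AddMonoidHom.inr_apply]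
  ring

theorem sum_signedQuadraticChar_prod_mul_addChar_ne_zero {p q r : ℕ} [Fact p.Prime]
    [Fact q.Prime] [Fact r.Prime] (hp : p ≠ 2) (hq : q ≠ 2) (hr : r ≠ 2) {ε : ℤ} (hε : ε ^ 2 = 1)
    (ψ : AddChar (ZMod p × ZMod q) (ZMod r)) :
    ∑ c, (signedQuadraticChar ε c.1 : ZMod r) * signedQuadraticChar ε c.2 * ψ c ≠ 0 := by
  rw [sum_prod_mul_addChar (fun a => (signedQuadraticChar ε a : ZMod r))
    (fun b => (signedQuadraticChar ε b : ZMod r)), sum_signedQuadraticChar_mul_addChar,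
    sum_signedQuadraticChar_mul_addChar]
  exact mul_ne_zero (one_add_mul_quadraticGaussSum_ne_zero hp hr hε _)
    (one_add_mul_quadraticGaussSum_ne_zero hq hr hε _)

end NonvanishingGaussSum

section CyclotomicClasses

theorem ne_two_of_gcd_sub_one_eq_two {p q : ℕ} (h : (p - 1).gcd (q - 1) = 2) :
    p ≠ 2 ∧ q ≠ 2 :=
  ⟨by rintro rfl; simp at h, by rintro rfl; simp at h⟩

namespace IsPrimitiveRootMod

variable {p : ℕ} {g : ℤ}

theorem pow_eq_pow (hg : IsPrimitiveRootMod g p) {m n : ℕ} (h : m ≡ n [MOD p - 1]) :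
    (g : ZMod p) ^ m = (g : ZMod p) ^ n := by
  rw [← pow_mod_orderOf (g : ZMod p) m, ← pow_mod_orderOf (g : ZMod p) n, hg, h]

variable [Fact p.Prime]

theorem exists_pow_eq (hg : IsPrimitiveRootMod g p) {y : ZMod p} (hy : y ≠ 0) :
    ∃ k < p - 1, (g : ZMod p) ^ k = y := by
  have : NeZero (p - 1) := ⟨Nat.sub_ne_zero_of_lt (Fact.out : p.Prime).one_lt⟩
  have h : IsPrimitiveRoot (g : ZMod p) (p - 1) := hg ▸ IsPrimitiveRoot.orderOf (g : ZMod p)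
  exact h.eq_pow_of_pow_eq_one (ZMod.pow_card_sub_one_eq_one hy)

theorem ne_zero (hg : IsPrimitiveRootMod g p) : (g : ZMod p) ≠ 0 := by
  intro h
  have h1 := pow_orderOf_eq_one (g : ZMod p)
  rw [hg, h, zero_pow (Nat.sub_ne_zero_of_lt (Fact.out : p.Prime).one_lt)] at h1
  exact zero_ne_one h1

theorem quadraticChar_pow (hg : IsPrimitiveRootMod g p) (hp : p ≠ 2) (k : ℕ) :
    quadraticChar (ZMod p) ((g : ZMod p) ^ k) = (-1) ^ k := by
  have hneg : quadraticChar (ZMod p) (g : ZMod p) = -1 := by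
    obtain ⟨a, ha⟩ :=
      quadraticChar_exists_neg_one' (F := ZMod p) (by rwa [ZMod.ringChar_zmod_n])
    obtain ⟨m, -, hm⟩ := hg.exists_pow_eq a.ne_zero
    refine (quadraticChar_dichotomy hg.ne_zero).resolve_left fun h => ?_
    rw [← hm, map_pow, h, one_pow] at ha
    norm_num at ha
  rw [map_pow, hneg]

theorem quadraticChar_div_pow_eq_one_iff (hg : IsPrimitiveRootMod g p) (hp : p ≠ 2) {y : ZMod p}
    {i : ℕ} :
    quadraticChar (ZMod p) (y / (g : ZMod p) ^ i) = 1 ↔ quadraticChar (ZMod p) y = (-1) ^ i := by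
  rw [quadraticChar_div, hg.quadraticChar_pow hp]
  rcases neg_one_pow_eq_or ℤ i with h | h <;> rw [h] <;> constructor <;> intro <;> linarith

theorem exists_pow_eq_and_pow_eq {q : ℕ} [Fact q.Prime] (hgp : IsPrimitiveRootMod g p)
    (hgq : IsPrimitiveRootMod g q) (hgcd : (p - 1).gcd (q - 1) = 2) {a : ZMod p} {b : ZMod q}
    (hab : quadraticChar (ZMod p) a * quadraticChar (ZMod q) b = 1) :
    ∃ s < (p - 1) * (q - 1) / 2, (g : ZMod p) ^ s = a ∧ (g : ZMod q) ^ s = b := by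
  obtain ⟨hp, hq⟩ := ne_two_of_gcd_sub_one_eq_two hgcd
  have ha : a ≠ 0 := quadraticChar_eq_zero_iff.not.mp (left_ne_zero_of_mul_eq_one hab)
  have hb : b ≠ 0 := quadraticChar_eq_zero_iff.not.mp (right_ne_zero_of_mul_eq_one hab)
  obtain ⟨k, hk, rfl⟩ := hgp.exists_pow_eq ha
  obtain ⟨l, hl, rfl⟩ := hgq.exists_pow_eq hb
  have hkl : k ≡ l [MOD (p - 1).gcd (q - 1)] := by
    rw [hgp.quadraticChar_pow hp, hgq.quadraticChar_pow hq, ← pow_add,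
      neg_one_pow_eq_one_iff_even (by norm_num), Nat.even_iff] at hab
    rw [hgcd, Nat.ModEq]
    omega
  obtain ⟨hsk, hsl⟩ := (Nat.chineseRemainder' hkl).2
  have hlt := Nat.chineseRemainder'_lt_lcm hkl (by omega) (by omega)
  rw [Nat.lcm, hgcd] at hlt
  exact ⟨_, hlt, hgp.pow_eq_pow hsk, hgq.pow_eq_pow hsl⟩

end IsPrimitiveRootMod

theorem exists_mem_cyclotomicClass_mul_eq_iff {p : ℕ} [Fact p.Prime] {g : ℤ}
    (hg : IsPrimitiveRootMod g p) (hp : p ≠ 2) {i : ℕ} {c y : ZMod p} (hc : c ≠ 0) :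
    (∃ z ∈ cyclotomicClass p g i, (z : ZMod p) * c = y) ↔
      quadraticChar (ZMod p) y * quadraticChar (ZMod p) c = (-1) ^ i := by
  rw [← quadraticChar_div]
  simp only [cyclotomicClass, ← eq_div_iff hc, mem_image, mem_range, exists_exists_and_eq_and,
    ZMod.intCast_mod, Int.cast_pow]
  constructor
  · rintro ⟨t, -, h⟩
    rw [← h, hg.quadraticChar_pow hp, pow_add, pow_mul, neg_one_sq, one_pow, one_mul]
  · intro h
    have h1 := (hg.quadraticChar_div_pow_eq_one_iff hp).mpr h
    have hy : y / c / (g : ZMod p) ^ i ≠ 0 := by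
      rw [Ne, ← quadraticChar_eq_zero_iff, h1]
      exact one_ne_zero
    obtain ⟨k, hk, hky⟩ := hg.exists_pow_eq hy
    rw [← hky, hg.quadraticChar_pow hp, neg_one_pow_eq_one_iff_even (by norm_num)] at h1
    obtain ⟨t, rfl⟩ := even_iff_exists_two_mul.mp h1
    have hodd := Nat.odd_iff.mp ((Fact.out : p.Prime).odd_of_ne_two hp)
    refine ⟨t, by omega, ?_⟩
    rwa [eq_div_iff (pow_ne_zero i hg.ne_zero), ← pow_add] at hky

theorem natCast_zmod_ne_zero_of_coprime {p n : ℕ} [Fact p.Prime] (hco : p.Coprime n) :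
    (n : ZMod p) ≠ 0 :=
  ((ZMod.isUnit_iff_coprime n p).mpr hco.symm).ne_zero

section ChineseRemainder

variable {p q : ℕ} (hco : p.Coprime q) {g x : ℤ} {i : ℕ} {a : ZMod p} {b : ZMod q}

theorem intCast_eq_chineseRemainder_symm_iff {z : ℤ} :
    (z : ZMod (p * q)) = (ZMod.chineseRemainder hco).symm (a, b) ↔
      (z : ZMod p) = a ∧ (z : ZMod q) = b := by
  rw [RingEquiv.eq_symm_apply, map_intCast, Prod.ext_iff, Prod.fst_intCast, Prod.snd_intCast]

theorem chineseRemainder_symm_mem_whitemanClass_iff [Fact p.Prime] [Fact q.Prime]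
    (hgcd : (p - 1).gcd (q - 1) = 2) (hgp : IsPrimitiveRootMod g p)
    (hgq : IsPrimitiveRootMod g q) (hxp : (x : ZMod p) = g) (hxq : (x : ZMod q) = 1) :
    (ZMod.chineseRemainder hco).symm (a, b) ∈ whitemanClass p q g x i ↔
      quadraticChar (ZMod p) a * quadraticChar (ZMod q) b = (-1) ^ i := by
  obtain ⟨hp, hq⟩ := ne_two_of_gcd_sub_one_eq_two hgcd
  have hmem : (ZMod.chineseRemainder hco).symm (a, b) ∈ whitemanClass p q g x i ↔
      ∃ s < (p - 1) * (q - 1) / 2,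
        (g : ZMod p) ^ s * (g : ZMod p) ^ i = a ∧ (g : ZMod q) ^ s = b := by
    simp only [whitemanClass, mem_image, mem_range, ← Int.cast_pow, ← Int.cast_mul,
      intCast_eq_chineseRemainder_symm_iff]
    simp only [Int.cast_mul, Int.cast_pow, hxp, hxq, one_pow, mul_one]
  rw [hmem]
  constructor
  · rintro ⟨s, -, rfl, rfl⟩
    rw [map_mul, hgp.quadraticChar_pow hp, hgp.quadraticChar_pow hp, hgq.quadraticChar_pow hq,
      mul_right_comm, ← mul_pow, neg_one_mul, neg_neg, one_pow, one_mul]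
  · intro h
    have hquot : quadraticChar (ZMod p) (a / (g : ZMod p) ^ i) * quadraticChar (ZMod q) b = 1 := by
      rw [quadraticChar_div, hgp.quadraticChar_pow hp, mul_right_comm, h, ← mul_pow, neg_one_mul,
        neg_neg, one_pow]
    obtain ⟨s, hs, ha, hb⟩ := hgp.exists_pow_eq_and_pow_eq hgq hgcd hquot
    exact ⟨s, hs, (eq_div_iff (pow_ne_zero i hgp.ne_zero)).mp ha, hb⟩

theorem chineseRemainder_symm_mem_scaledClassP_iff [Fact p.Prime] (hp : p ≠ 2)
    (hg : IsPrimitiveRootMod g p) :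
    (ZMod.chineseRemainder hco).symm (a, b) ∈ scaledClassP p q g i ↔
      b = 0 ∧ quadraticChar (ZMod p) a * quadraticChar (ZMod p) q = (-1) ^ i := by
  rw [← exists_mem_cyclotomicClass_mul_eq_iff hg hp (natCast_zmod_ne_zero_of_coprime hco)]
  simp only [scaledClassP, mem_image, intCast_eq_chineseRemainder_symm_iff]
  simp only [Int.cast_mul, Int.cast_natCast, ZMod.natCast_self, mul_zero, ← and_assoc,
    exists_and_right]
  rw [and_comm, eq_comm (a := b)]

theorem chineseRemainder_symm_mem_scaledClassQ_iff [Fact q.Prime] (hq : q ≠ 2)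
    (hg : IsPrimitiveRootMod g q) :
    (ZMod.chineseRemainder hco).symm (a, b) ∈ scaledClassQ p q g i ↔
      a = 0 ∧ quadraticChar (ZMod q) b * quadraticChar (ZMod q) p = (-1) ^ i := by
  rw [← exists_mem_cyclotomicClass_mul_eq_iff hg hq (natCast_zmod_ne_zero_of_coprime hco.symm)]
  simp only [scaledClassQ, mem_image, intCast_eq_chineseRemainder_symm_iff]
  simp only [Int.cast_mul, Int.cast_natCast, ZMod.natCast_self, mul_zero,
    and_left_comm (b := 0 = a), exists_and_left]
  rw [eq_comm (a := a)]

theorem signedIndicator_whitemanSupport [Fact p.Prime] [Fact q.Prime]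
    (hgcd : (p - 1).gcd (q - 1) = 2) (hgp : IsPrimitiveRootMod g p)
    (hgq : IsPrimitiveRootMod g q) (hxp : (x : ZMod p) = g) (hxq : (x : ZMod q) = 1)
    {ε : ℤ} (hεp : quadraticChar (ZMod p) q = ε) (hεq : quadraticChar (ZMod q) p = ε) :
    signedIndicator (whitemanSupport p q g x) ((ZMod.chineseRemainder hco).symm (a, b)) =
      signedQuadraticChar ε a * signedQuadraticChar ε b := by
  obtain ⟨hp, hq⟩ := ne_two_of_gcd_sub_one_eq_two hgcd
  have hε : ε = 1 ∨ ε = -1 :=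
    hεp ▸ quadraticChar_dichotomy (natCast_zmod_ne_zero_of_coprime hco)
  simp only [signedIndicator, signedQuadraticChar, whitemanSupport, mem_union,
    chineseRemainder_symm_mem_whitemanClass_iff hco hgcd hgp hgq hxp hxq,
    chineseRemainder_symm_mem_scaledClassP_iff hco hp hgp,
    chineseRemainder_symm_mem_scaledClassQ_iff hco hq hgq, hεp, hεq, pow_one]
  by_cases ha : a = 0 <;> by_cases hb : b = 0
  · simp [ha, hb]
  · rcases quadraticChar_dichotomy hb with hχb | hχb <;> rcases hε with rfl | rfl <;>
      simp [ha, hb, hχb]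
  · rcases quadraticChar_dichotomy ha with hχa | hχa <;> rcases hε with rfl | rfl <;>
      simp [ha, hb, hχa]
  · rcases quadraticChar_dichotomy ha with hχa | hχa <;>
      rcases quadraticChar_dichotomy hb with hχb | hχb <;> rcases hε with rfl | rfl <;>
      simp [ha, hb, hχa, hχb]

end ChineseRemainder

theorem sum_signedIndicator_whitemanSupport_mul_addChar_ne_zero {p q : ℕ} [Fact p.Prime]
    [Fact q.Prime] [NeZero (p * q)] (hco : p.Coprime q) (hgcd : (p - 1).gcd (q - 1) = 2)
    {g x : ℤ} (hgp : IsPrimitiveRootMod g p) (hgq : IsPrimitiveRootMod g q)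
    (hxp : (x : ZMod p) = g) (hxq : (x : ZMod q) = 1)
    {ε : ℤ} (hεp : quadraticChar (ZMod p) q = ε) (hεq : quadraticChar (ZMod q) p = ε)
    {r : ℕ} [Fact r.Prime] (hr : r ≠ 2) (ψ : AddChar (ZMod (p * q)) (ZMod r)) :
    ∑ j, (signedIndicator (whitemanSupport p q g x) j : ZMod r) * ψ j ≠ 0 := by
  obtain ⟨hp, hq⟩ := ne_two_of_gcd_sub_one_eq_two hgcd
  have hε : ε ^ 2 = 1 := hεp ▸ quadraticChar_sq_one (natCast_zmod_ne_zero_of_coprime hco)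
  let e := (ZMod.chineseRemainder hco).symm
  let φ := ψ.compAddMonoidHom (e : ZMod p × ZMod q →+ ZMod (p * q))
  have hsum : ∑ j, (signedIndicator (whitemanSupport p q g x) j : ZMod r) * ψ j =
      ∑ c, (signedQuadraticChar ε c.1 : ZMod r) * signedQuadraticChar ε c.2 * φ c := by
    rw [← e.toEquiv.sum_comp]
    refine sum_congr rfl fun c _ => ?_
    rw [← Int.cast_mul,
      ← signedIndicator_whitemanSupport hco hgcd hgp hgq hxp hxq hεp hεq]
    rfl
  rw [hsum]
  exact sum_signedQuadraticChar_prod_mul_addChar_ne_zero hp hq hr hε φ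

end CyclotomicClasses

section Parameters

variable {p q : ℕ}

theorem coprime_of_gcd_sub_one_eq_two (hp : p.Prime) (hq : q.Prime)
    (hgcd : (p - 1).gcd (q - 1) = 2) (h4 : p ≡ 1 [MOD 4] ∨ q ≡ 1 [MOD 4]) : p.Coprime q := by
  refine (Nat.coprime_primes hp hq).mpr ?_
  rintro rfl
  rw [Nat.gcd_self] at hgcd
  rw [or_self, Nat.ModEq] at h4
  omega

theorem gcd_sub_one_add_two_sub_one (hp : p ≡ 1 [MOD 2]) : (p - 1).gcd (p + 2 - 1) = 2 := by
  obtain ⟨k, rfl⟩ := Nat.odd_iff.mpr hp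
  have h : 2 * k + 1 + 2 - 1 = 2 + 2 * k := by omega
  rw [h, Nat.add_sub_cancel, Nat.gcd_add_self_right, Nat.gcd_eq_right (Nat.dvd_mul_right 2 k)]

theorem quadraticChar_natCast_comm [Fact p.Prime] [Fact q.Prime] (hp : p ≠ 2) (hq : q ≠ 2)
    (h4 : p ≡ 1 [MOD 4] ∨ q ≡ 1 [MOD 4]) :
    quadraticChar (ZMod q) p = quadraticChar (ZMod p) q := by
  rcases h4 with h | h
  · simpa [legendreSym] using legendreSym.quadratic_reciprocity_one_mod_four h hq
  · simpa [legendreSym] using (legendreSym.quadratic_reciprocity_one_mod_four h hp).symm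

end Parameters

theorem theorem2_general {p q : ℕ} (hp : p.Prime) (hq : q.Prime)
    (hgcd : (p - 1).gcd (q - 1) = 2) (h4 : p ≡ 1 [MOD 4] ∨ q ≡ 1 [MOD 4]) {g x : ℤ}
    (hgp : IsPrimitiveRootMod g p) (hgq : IsPrimitiveRootMod g q)
    (hxp : x ≡ g [ZMOD (p : ℤ)]) (hxq : x ≡ 1 [ZMOD (q : ℤ)]) :
    twoAdicComplexity (p * q) (whitemanSequence p q g x) = p * q := by
  have : Fact p.Prime := ⟨hp⟩
  have : Fact q.Prime := ⟨hq⟩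
  have : NeZero (p * q) := ⟨mul_ne_zero hp.ne_zero hq.ne_zero⟩
  obtain ⟨hp2, hq2⟩ := ne_two_of_gcd_sub_one_eq_two hgcd
  have hco : p.Coprime q := coprime_of_gcd_sub_one_eq_two hp hq hgcd h4
  have hxp' : (x : ZMod p) = g := (ZMod.intCast_eq_intCast_iff _ _ _).mpr hxp
  have hxq' : (x : ZMod q) = 1 := by simpa using (ZMod.intCast_eq_intCast_iff _ _ _).mpr hxq
  exact twoAdicComplexity_indicator_eq _ fun r _ hr ψ _ =>
    sum_signedIndicator_whitemanSupport_mul_addChar_ne_zero hco hgcd hgp hgq hxp' hxq' rfl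
      (quadraticChar_natCast_comm hp2 hq2 h4) hr ψ

theorem theorem2 (p q : ℕ) (hp : p.Prime) (hq : q.Prime)
    (hp4 : p ≡ 1 [MOD 4]) (hq4 : q ≡ 3 [MOD 4]) (hpq : q = p + 2)
    (g x : ℤ) (hgp : IsPrimitiveRootMod g p) (hgq : IsPrimitiveRootMod g q)
    (hxp : x ≡ g [ZMOD (p : ℤ)]) (hxq : x ≡ 1 [ZMOD (q : ℤ)]) :
    twoAdicComplexity (p * q) (whitemanSequence p q g x) = p * q :=
  theorem2_general hp hq (hpq ▸ gcd_sub_one_add_two_sub_one (hp4.of_mul_right 2))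
    (Or.inl hp4) hgp hgq hxp hxq
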